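/- All vector spaces are complex. A \emph{matrix-norm} on a vector space $V$ is a family of norms $\|\cdot\|_{V,m,n}$ on the spaces $M_{m,n}(V)$ of $m\times n$ matrices over $V$ such that $\|ABC\|_{V,k,l}\le\|A\|\,\|B\|_{V,m,n}\,\|C\|$ for all $A\in M_{k,m}(\mathbb{C})$, $B\in M_{m,n}(V)$, $C\in M_{n,l}(\mathbb{C})$, where scalar matrices carry the operator norm between Euclidean spaces; $V$ is normed by $M_{1,1}(V)\cong V$. A \emph{matricial Banach space} is a complete space with a matrix-norm. A linear map $\phi:V\to W$ between such spaces is \emph{completely contractive} if $\|(\phi(A_{jk}))\|_{W,m,n}\le\|A\|_{V,m,n}$ for all $m,n$ and all $A\in M_{m,n}(V)$. A \emph{matricial Banach algebra} is a matricial Banach space with an associative bilinear (not necessarily unital) product such that $\|AB\|_{m,n}\le\|A\|_{m,p}\|B\|_{p,n}$ for all $A\in M_{m,p}$, $B\in M_{p,n}$ over it. For matricial Banach spaces $V,W$ the \emph{Haagerup tensor product} $V\otimes_h W$ is the completion of the algebraic tensor product $V\otimes W$ with the matrix-norm $$\|C\|_{m,n}=\inf\Big\{\sum_{l=1}^{p}\|A_l\|_{V,m,q_l}\|B_l\|_{W,q_l,n}\;:\;C=\sum_{l=1}^{p}A_l\odot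 B_l\Big\},\qquad (A\odot B)_{ik}=\sum_j A_{ij}\otimes B_{jk},$$ the matrix-norms being extended to the completion as entrywise limits. Put $V^{\otimes_h 1}=V$ and $V^{\otimes_h(n+1)}=V^{\otimes_h n}\otimes_h V$ for $n\ge 1$. The \emph{Haagerup tensor algebra} $\mathcal{T}_h(V)$ is the $\ell^1$-direct sum of the spaces $V^{\otimes_h n}$, $n\ge1$, with the norms $\|A\|_{m,n}=\sum_{k\ge1}\|\pi_k(A)\|_{V^{\otimes_h k},m,n}$, where $\pi_k(A)$ is the matrix of $k$-th coordinates of the entries of $A$. Its product is the one determined by the canonical completely contractive bilinear maps $V^{\otimes_h m}\times V^{\otimes_h n}\to V^{\otimes_h(m+n)}$, which send $(v_1\otimes\cdots\otimes v_m,\,w_1\otimes\cdots\otimes w_n)$ to $v_1\otimes\cdots\otimes v_m\otimes w_1\otimes\cdots\otimes w_n$. Let $\epsilon_V:V\to\mathcal{T}_h(V)$ be the inclusion of $V$ as the first tensor power. \textbf{Theorem (Universal property of the Haagerup tensor algebra).} For every matricial Banach space $V$, $\mathcal{T}_h(V)$ is a matricial Banach algebra. Moreover, for every matricial Banach algebra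 $\mathcal{B}$ and every completely contractive linear map $\phi:V\to\mathcal{B}$ there is a unique completely contractive algebra homomorphism $\hat\phi:\mathcal{T}_h(V)\to\mathcal{B}$ such that $\hat\phi\circ\epsilon_V=\phi$. -/

import Mathlib

set_option linter.unusedSectionVars false

namespace MatricialBanach

noncomputable section

open Filter Topology
open scoped TensorProduct

universe u v w

/-- The operator norm of a complex `m × n` matrix, from `ℂⁿ` to `ℂᵐ` with Euclidean norms. -/
def opNorm {m n : ℕ} (A : Matrix (Fin m) (Fin n) ℂ) : ℝ :=
  ‖LinearMap.toContinuousLinearMap (Matrix.toEuclideanLin A)‖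

section ScalarAction

variable {V : Type*} [AddCommGroup V] [Module ℂ V]

/-- The product `A B` of a scalar matrix `A` and a matrix `B` over `V`. -/
def lmul {k m n : ℕ} (A : Matrix (Fin k) (Fin m) ℂ) (B : Matrix (Fin m) (Fin n) V) :
    Matrix (Fin k) (Fin n) V :=
  Matrix.of fun i j => ∑ a, A i a • B a j

/-- The product `B C` of a matrix `B` over `V` and a scalar matrix `C`. -/
def rmul {m n l : ℕ} (B : Matrix (Fin m) (Fin n) V) (C : Matrix (Fin n) (Fin l) ℂ) :
    Matrix (Fin m) (Fin l) V :=
  Matrix.of fun i j => ∑ b, C b j • B i b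

end ScalarAction

/-- A matrix-norm on a normed space `V`: a norm on each space `M_{m,n}(V)` such that
`‖A B C‖ ≤ ‖A‖ ‖B‖ ‖C‖` for scalar matrices `A`, `C`; the norm of `V` itself is the norm on
`M_{1,1}(V) ≅ V`. -/
class MatrixNormedSpace (V : Type u) [NormedAddCommGroup V] [NormedSpace ℂ V] where
  mnorm : ∀ {m n : ℕ}, Matrix (Fin m) (Fin n) V → ℝ
  mnorm_add_le : ∀ {m n : ℕ} (A B : Matrix (Fin m) (Fin n) V),
    mnorm (A + B) ≤ mnorm A + mnorm B
  mnorm_smul : ∀ {m n : ℕ} (c : ℂ) (A : Matrix (Fin m) (Fin n) V),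
    mnorm (c • A) = ‖c‖ * mnorm A
  eq_zero_of_mnorm : ∀ {m n : ℕ} (A : Matrix (Fin m) (Fin n) V), mnorm A = 0 → A = 0
  mnorm_mul_mul_le : ∀ {k m n l : ℕ} (A : Matrix (Fin k) (Fin m) ℂ)
    (B : Matrix (Fin m) (Fin n) V) (C : Matrix (Fin n) (Fin l) ℂ),
    mnorm (rmul (lmul A B) C) ≤ opNorm A * mnorm B * opNorm C
  mnorm_single : ∀ v : V, mnorm (Matrix.of fun (_ _ : Fin 1) => v) = ‖v‖

open MatrixNormedSpace (mnorm)

section Basic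

open scoped Matrix.Norms.L2Operator in
lemma opNorm_eq {m n : ℕ} (A : Matrix (Fin m) (Fin n) ℂ) : opNorm A = ‖A‖ := by
  rw [Matrix.l2_opNorm_def]; rfl

lemma opNorm_nonneg {m n : ℕ} (A : Matrix (Fin m) (Fin n) ℂ) : 0 ≤ opNorm A := norm_nonneg _

open scoped Matrix.Norms.L2Operator in
lemma opNorm_one_le (n : ℕ) : opNorm (1 : Matrix (Fin n) (Fin n) ℂ) ≤ 1 := by
  rw [opNorm_eq, ← Matrix.diagonal_one, Matrix.l2_opNorm_diagonal, pi_norm_le_iff_of_nonneg (by simp)]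
  simp

/-- Column matrix of a scalar vector. -/
def colMat {n : ℕ} (x : Fin n → ℂ) : Matrix (Fin n) (Fin 1) ℂ := Matrix.of fun i _ => x i

/-- Row matrix of a scalar vector. -/
def rowMat {n : ℕ} (x : Fin n → ℂ) : Matrix (Fin 1) (Fin n) ℂ := Matrix.of fun _ i => x i

open scoped Matrix.Norms.L2Operator in
lemma opNorm_colMat {n : ℕ} (x : Fin n → ℂ) : opNorm (colMat x) ^ 2 = ∑ i, ‖x i‖ ^ 2 := by
  rw [opNorm_eq, sq, ← Matrix.l2_opNorm_conjTranspose_mul_self]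
  have : (colMat x).conjTranspose * colMat x =
      Matrix.diagonal (fun _ : Fin 1 => ((∑ i, ‖x i‖ ^ 2 : ℝ) : ℂ)) := by
    ext i j
    fin_cases i; fin_cases j
    simp [Matrix.mul_apply, colMat, Complex.conj_mul']
  rw [this, Matrix.l2_opNorm_diagonal, Pi.norm_def]
  simp only [Finset.univ_unique, Finset.sup_singleton, coe_nnnorm, Complex.norm_real,
    Real.norm_eq_abs]
  exact abs_of_nonneg (Finset.sum_nonneg fun _ _ => by positivity)

open scoped Matrix.Norms.L2Operator in
lemma opNorm_rowMat {n : ℕ} (x : Fin n → ℂ) : opNorm (rowMat x) ^ 2 = ∑ i, ‖x i‖ ^ 2 := by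
  have : rowMat x = (colMat (fun i => star (x i))).conjTranspose := by
    ext i j; simp [rowMat, colMat]
  rw [this, opNorm_eq, Matrix.l2_opNorm_conjTranspose, ← opNorm_eq, opNorm_colMat]
  simp

lemma opNorm_colMat_single {n : ℕ} (i : Fin n) : opNorm (colMat (Pi.single i 1)) = 1 := by
  have h := opNorm_colMat (Pi.single (M := fun _ : Fin n => ℂ) i 1)
  rw [Finset.sum_eq_single i] at h
  · rw [Pi.single_eq_same, norm_one] at h
    exact (pow_left_inj₀ (opNorm_nonneg _) zero_le_one two_ne_zero).1 h
  · intro b _ hb; simp [hb]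
  · simp

lemma opNorm_rowMat_single {n : ℕ} (i : Fin n) : opNorm (rowMat (Pi.single i 1)) = 1 := by
  have h := opNorm_rowMat (Pi.single (M := fun _ : Fin n => ℂ) i 1)
  rw [Finset.sum_eq_single i] at h
  · rw [Pi.single_eq_same, norm_one] at h
    exact (pow_left_inj₀ (opNorm_nonneg _) zero_le_one two_ne_zero).1 h
  · intro b _ hb; simp [hb]
  · simp

variable {V : Type u} [NormedAddCommGroup V] [NormedSpace ℂ V] {k m n l : ℕ}

lemma rmul_one (A : Matrix (Fin m) (Fin n) V) : rmul A 1 = A := by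
  ext i j; simp [rmul, Matrix.one_apply]

lemma lmul_one (A : Matrix (Fin m) (Fin n) V) : lmul 1 A = A := by
  ext i j; simp [lmul, Matrix.one_apply]

variable [MatrixNormedSpace V]

lemma mnorm_zero : mnorm (0 : Matrix (Fin m) (Fin n) V) = 0 := by
  simpa using MatrixNormedSpace.mnorm_smul 0 (0 : Matrix (Fin m) (Fin n) V)

lemma mnorm_neg (A : Matrix (Fin m) (Fin n) V) : mnorm (-A) = mnorm A := by
  simpa using MatrixNormedSpace.mnorm_smul (-1) A

lemma mnorm_nonneg (A : Matrix (Fin m) (Fin n) V) : 0 ≤ mnorm A := by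
  have h := MatrixNormedSpace.mnorm_add_le A (-A)
  rw [add_neg_cancel, mnorm_zero, mnorm_neg] at h
  linarith

lemma mnorm_sum_le {ι : Type*} (s : Finset ι) (A : ι → Matrix (Fin m) (Fin n) V) :
    mnorm (∑ i ∈ s, A i) ≤ ∑ i ∈ s, mnorm (A i) :=
  Finset.le_sum_of_subadditive _ mnorm_zero.le MatrixNormedSpace.mnorm_add_le s A

lemma mnorm_lmul_le (A : Matrix (Fin k) (Fin m) ℂ) (B : Matrix (Fin m) (Fin n) V) :
    mnorm (lmul A B) ≤ opNorm A * mnorm B := by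
  have h := MatrixNormedSpace.mnorm_mul_mul_le A B (1 : Matrix (Fin n) (Fin n) ℂ)
  rw [rmul_one] at h
  exact h.trans (mul_le_of_le_one_right (mul_nonneg (opNorm_nonneg _) (mnorm_nonneg _))
    (opNorm_one_le n))

lemma mnorm_rmul_le (B : Matrix (Fin m) (Fin n) V) (C : Matrix (Fin n) (Fin l) ℂ) :
    mnorm (rmul B C) ≤ mnorm B * opNorm C := by
  have h := MatrixNormedSpace.mnorm_mul_mul_le (1 : Matrix (Fin m) (Fin m) ℂ) B C
  rw [lmul_one] at h
  refine h.trans (mul_le_mul_of_nonneg_right ?_ (opNorm_nonneg _))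
  exact mul_le_of_le_one_left (mnorm_nonneg _) (opNorm_one_le m)

lemma mnorm_entry_le (A : Matrix (Fin m) (Fin n) V) (i : Fin m) (j : Fin n) :
    ‖A i j‖ ≤ mnorm A := by
  have h := MatrixNormedSpace.mnorm_mul_mul_le (rowMat (Pi.single i 1)) A
    (colMat (Pi.single j 1))
  rw [opNorm_rowMat_single, opNorm_colMat_single, one_mul, mul_one] at h
  rw [← MatrixNormedSpace.mnorm_single]
  convert h using 2
  ext a b
  simp [rmul, lmul, rowMat, colMat, Pi.single_apply, ite_smul]

lemma mnorm_le_sum (A : Matrix (Fin m) (Fin n) V) : mnorm A ≤ ∑ i, ∑ j, ‖A i j‖ := by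
  have hA : A = ∑ i, ∑ j, rmul (lmul (colMat (Pi.single i 1))
      (Matrix.of fun (_ _ : Fin 1) => A i j)) (rowMat (Pi.single j 1)) := by
    ext a b
    simp [Matrix.sum_apply, rmul, lmul, rowMat, colMat, Pi.single_apply, ite_smul]
  calc mnorm A = _ := congrArg _ hA
    _ ≤ _ := (mnorm_sum_le _ _).trans (Finset.sum_le_sum fun i _ => (mnorm_sum_le _ _).trans
      (Finset.sum_le_sum fun j _ => ?_))
  refine (MatrixNormedSpace.mnorm_mul_mul_le _ _ _).trans ?_
  rw [opNorm_rowMat_single, opNorm_colMat_single, one_mul, mul_one,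
    MatrixNormedSpace.mnorm_single]

lemma abs_mnorm_sub_le (A B : Matrix (Fin m) (Fin n) V) :
    |mnorm A - mnorm B| ≤ mnorm (A - B) := by
  have h1 := MatrixNormedSpace.mnorm_add_le (A - B) B
  have h2 := MatrixNormedSpace.mnorm_add_le (B - A) A
  rw [sub_add_cancel] at h1 h2
  rw [← neg_sub A B, mnorm_neg] at h2
  rw [abs_le]; constructor <;> linarith

lemma uniformContinuous_mnorm :
    UniformContinuous (mnorm : Matrix (Fin m) (Fin n) V → ℝ) := by
  have h : LipschitzWith ((m * n : ℕ) : NNReal)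
      (fun A : Fin m → Fin n → V => mnorm (Matrix.of A)) := by
    refine LipschitzWith.of_dist_le_mul fun A B => ?_
    rw [Real.dist_eq, dist_eq_norm]
    refine (abs_mnorm_sub_le _ _).trans ((mnorm_le_sum _).trans ?_)
    calc ∑ i, ∑ j, ‖(Matrix.of A - Matrix.of B) i j‖ ≤ ∑ _i : Fin m, ∑ _j : Fin n, ‖A - B‖ :=
          Finset.sum_le_sum fun i _ => Finset.sum_le_sum fun j _ =>
            (norm_le_pi_norm ((A - B) i) j).trans (norm_le_pi_norm (A - B) i)
      _ = _ := by simp [mul_assoc]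
  exact h.uniformContinuous

end Basic

section Completion

open UniformSpace

variable {V : Type u} [NormedAddCommGroup V] {m n : ℕ}

/-- Entrywise embedding of `M_{m,n}(V)` into `M_{m,n}` of the metric completion of `V`. -/
def coeMat (A : Matrix (Fin m) (Fin n) V) : Matrix (Fin m) (Fin n) (Completion V) :=
  A.map (fun v => (v : Completion V))

lemma isUniformInducing_coeMat :
    IsUniformInducing (coeMat : Matrix (Fin m) (Fin n) V → Matrix (Fin m) (Fin n) (Completion V)) := by
  have h1 : Isometry (fun v : V => (v : Completion V)) := Completion.coe_isometry
  have h2 : Isometry (fun (A : Fin m → Fin n → V) i j => (A i j : Completion V)) :=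
    Isometry.piMap _ fun _ => Isometry.piMap _ fun _ => h1
  exact h2.isUniformInducing

lemma denseRange_coeMat :
    DenseRange (coeMat : Matrix (Fin m) (Fin n) V → Matrix (Fin m) (Fin n) (Completion V)) :=
  DenseRange.piMap fun _ => DenseRange.piMap fun _ => Completion.denseRange_coe

variable [NormedSpace ℂ V] [MatrixNormedSpace V]

/-- The matrix-norm of the completion: the limit of `‖B‖` as `B ∈ M_{m,n}(V)` tends
entrywise to `A`. -/
def completionNorm (A : Matrix (Fin m) (Fin n) (Completion V)) : ℝ :=
  limUnder (comap coeMat (𝓝 A)) (mnorm : Matrix (Fin m) (Fin n) V → ℝ)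

lemma continuous_completionNorm :
    Continuous (completionNorm : Matrix (Fin m) (Fin n) (Completion V) → ℝ) :=
  (uniformContinuous_uniformly_extend isUniformInducing_coeMat denseRange_coeMat
    uniformContinuous_mnorm).continuous

lemma completionNorm_coe (A : Matrix (Fin m) (Fin n) V) : completionNorm (coeMat A) = mnorm A :=
  uniformly_extend_of_ind isUniformInducing_coeMat denseRange_coeMat uniformContinuous_mnorm A

lemma completionNorm_add_le (A B : Matrix (Fin m) (Fin n) (Completion V)) :
    completionNorm (A + B) ≤ completionNorm A + completionNorm B := by
  have hc := continuous_completionNorm (V := V) (m := m) (n := n)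
  refine denseRange_coeMat.induction_on₂ ?_ ?_ A B
  · exact isClosed_le (hc.comp (continuous_fst.add continuous_snd))
      ((hc.comp continuous_fst).add (hc.comp continuous_snd))
  · intro A B
    have : coeMat A + coeMat B = coeMat (A + B) := by ext; simp [coeMat, Completion.coe_add]
    rw [this, completionNorm_coe, completionNorm_coe, completionNorm_coe]
    exact MatrixNormedSpace.mnorm_add_le A B

lemma completionNorm_smul (c : ℂ) (A : Matrix (Fin m) (Fin n) (Completion V)) :
    completionNorm (c • A) = ‖c‖ * completionNorm A := by
  have hc := continuous_completionNorm (V := V) (m := m) (n := n)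
  refine denseRange_coeMat.induction_on A ?_ ?_
  · exact isClosed_eq (hc.comp (continuous_const_smul c)) (continuous_const.mul hc)
  · intro A
    have : c • coeMat A = coeMat (c • A) := by ext; simp [coeMat]
    rw [this, completionNorm_coe, completionNorm_coe]
    exact MatrixNormedSpace.mnorm_smul c A

lemma completionNorm_entry_le (A : Matrix (Fin m) (Fin n) (Completion V)) (i : Fin m)
    (j : Fin n) : ‖A i j‖ ≤ completionNorm A := by
  have hc := continuous_completionNorm (V := V) (m := m) (n := n)
  refine denseRange_coeMat.induction_on A ?_ ?_
  · exact isClosed_le (continuous_id.matrix_elem i j).norm hc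
  · intro A
    rw [completionNorm_coe]
    simpa [coeMat] using mnorm_entry_le A i j

lemma completionNorm_mul_mul_le {k l : ℕ} (A : Matrix (Fin k) (Fin m) ℂ)
    (B : Matrix (Fin m) (Fin n) (Completion V)) (C : Matrix (Fin n) (Fin l) ℂ) :
    completionNorm (rmul (lmul A B) C) ≤ opNorm A * completionNorm B * opNorm C := by
  have hc := continuous_completionNorm (V := V) (m := m) (n := n)
  have hc' := continuous_completionNorm (V := V) (m := k) (n := l)
  refine denseRange_coeMat.induction_on B ?_ ?_
  · refine isClosed_le (hc'.comp (continuous_matrix fun i j => ?_))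
      ((continuous_const.mul hc).mul continuous_const)
    simp only [rmul, lmul, Matrix.of_apply]
    have h (a b) : Continuous fun B : Matrix (Fin m) (Fin n) (Completion V) => B a b :=
      continuous_id.matrix_elem a b
    have h' (b) : Continuous fun B : Matrix (Fin m) (Fin n) (Completion V) =>
        ∑ a, A i a • B a b :=
      continuous_finsetSum _ fun a _ => (continuous_const_smul (A i a)).comp (h a b)
    exact continuous_finsetSum _ fun b _ => (continuous_const_smul (C b j)).comp (h' b)
  · intro B
    have : rmul (lmul A (coeMat B)) C = coeMat (rmul (lmul A B) C) := by
      ext i j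
      simp only [rmul, lmul, coeMat, Matrix.of_apply, Matrix.map_apply, ← Completion.coe_toComplL (𝕜 := ℂ),
        map_sum, map_smul]
    rw [this, completionNorm_coe, completionNorm_coe]
    exact MatrixNormedSpace.mnorm_mul_mul_le A B C

instance completionMatrixNormedSpace : MatrixNormedSpace (Completion V) where
  mnorm := completionNorm
  mnorm_add_le := completionNorm_add_le
  mnorm_smul := completionNorm_smul
  eq_zero_of_mnorm A h := by
    ext i j
    exact norm_le_zero_iff.1 ((completionNorm_entry_le A i j).trans h.le)
  mnorm_mul_mul_le := completionNorm_mul_mul_le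
  mnorm_single v := by
    have hc := continuous_completionNorm (V := V) (m := 1) (n := 1)
    induction v using Completion.induction_on with
    | hp => exact isClosed_eq (hc.comp (continuous_matrix fun _ _ => continuous_id))
              continuous_norm
    | ih v =>
      rw [Completion.norm_coe, ← MatrixNormedSpace.mnorm_single, ← completionNorm_coe]
      rfl

end Completion

section Dual

variable {V : Type u} [NormedAddCommGroup V] [NormedSpace ℂ V] [MatrixNormedSpace V]

lemma sq_le_mul_imp {s s' c : ℝ} (hs : 0 ≤ s) (h : s' ^ 2 = s ^ 2) (hs' : 0 ≤ s')
    (hc : 0 ≤ c) (h2 : s ^ 2 ≤ c * s') : s ≤ c := by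
  have : s' = s := (pow_left_inj₀ hs' hs two_ne_zero).1 h
  subst this
  rcases hs.eq_or_lt with h0 | h0
  · rw [← h0]; exact hc
  · nlinarith

lemma opNorm_dual_row (f : StrongDual ℂ V) {q : ℕ} (A : Matrix (Fin 1) (Fin q) V) :
    opNorm (rowMat fun j => f (A 0 j)) ≤ ‖f‖ * mnorm A := by
  set x : Fin q → ℂ := fun j => star (f (A 0 j)) with hx
  refine sq_le_mul_imp (opNorm_nonneg _) (s' := opNorm (colMat x)) ?_ (opNorm_nonneg _)
    (mul_nonneg (norm_nonneg _) (mnorm_nonneg _)) ?_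
  · rw [opNorm_rowMat, opNorm_colMat]; simp [hx]
  · have h1 : f (rmul A (colMat x) 0 0) = ((∑ j, ‖f (A 0 j)‖ ^ 2 : ℝ) : ℂ) := by
      simp [rmul, colMat, hx, Complex.conj_mul']
    rw [opNorm_rowMat, mul_assoc]
    calc ∑ j, ‖f (A 0 j)‖ ^ 2 = ‖f (rmul A (colMat x) 0 0)‖ := by
          rw [h1, Complex.norm_real, Real.norm_of_nonneg (Finset.sum_nonneg fun _ _ => by positivity)]
      _ ≤ ‖f‖ * ‖rmul A (colMat x) 0 0‖ := f.le_opNorm _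
      _ ≤ _ := mul_le_mul_of_nonneg_left ((mnorm_entry_le _ _ _).trans (mnorm_rmul_le _ _))
        (norm_nonneg _)

lemma opNorm_dual_col (f : StrongDual ℂ V) {q : ℕ} (A : Matrix (Fin q) (Fin 1) V) :
    opNorm (colMat fun j => f (A j 0)) ≤ ‖f‖ * mnorm A := by
  set x : Fin q → ℂ := fun j => star (f (A j 0)) with hx
  refine sq_le_mul_imp (opNorm_nonneg _) (s' := opNorm (rowMat x)) ?_ (opNorm_nonneg _)
    (mul_nonneg (norm_nonneg _) (mnorm_nonneg _)) ?_
  · rw [opNorm_rowMat, opNorm_colMat]; simp [hx]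
  · have h1 : f (lmul (rowMat x) A 0 0) = ((∑ j, ‖f (A j 0)‖ ^ 2 : ℝ) : ℂ) := by
      simp [lmul, rowMat, hx, Complex.conj_mul']
    rw [opNorm_colMat, mul_assoc, mul_comm (mnorm A)]
    calc ∑ j, ‖f (A j 0)‖ ^ 2 = ‖f (lmul (rowMat x) A 0 0)‖ := by
          rw [h1, Complex.norm_real, Real.norm_of_nonneg (Finset.sum_nonneg fun _ _ => by positivity)]
      _ ≤ ‖f‖ * ‖lmul (rowMat x) A 0 0‖ := f.le_opNorm _
      _ ≤ _ := mul_le_mul_of_nonneg_left ((mnorm_entry_le _ _ _).trans (mnorm_lmul_le _ _))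
        (norm_nonneg _)

end Dual

section Haagerup

variable {V : Type u} {W : Type v} [NormedAddCommGroup V] [NormedSpace ℂ V]
  [NormedAddCommGroup W] [NormedSpace ℂ W] {k m n l : ℕ}

/-- The `φ`-matrix product `A ⊙_φ B` of matrices over `X` and `Y` along a bilinear map `φ`. -/
def bilinProd {X Y Z : Type*} [AddCommGroup X] [Module ℂ X] [AddCommGroup Y] [Module ℂ Y]
    [AddCommGroup Z] [Module ℂ Z] {m p n : ℕ} (φ : X →ₗ[ℂ] Y →ₗ[ℂ] Z)
    (A : Matrix (Fin m) (Fin p) X) (B : Matrix (Fin p) (Fin n) Y) :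
    Matrix (Fin m) (Fin n) Z :=
  Matrix.of fun i j => ∑ a, φ (A i a) (B a j)

variable (V W) in
/-- The algebraic tensor product `V ⊗ W` (carrying the Haagerup matrix-norm below). -/
def AlgTensor : Type max u v := V ⊗[ℂ] W

instance : AddCommGroup (AlgTensor V W) := inferInstanceAs (AddCommGroup (V ⊗[ℂ] W))
instance : Module ℂ (AlgTensor V W) := inferInstanceAs (Module ℂ (V ⊗[ℂ] W))

variable (V W) in
/-- The canonical bilinear map `(v, w) ↦ v ⊗ w`. -/
def algTmul : V →ₗ[ℂ] W →ₗ[ℂ] AlgTensor V W := TensorProduct.mk ℂ V W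

/-- The tensor matrix product `A ⊙ B`, with entries `∑ₐ A i a ⊗ B a j`. -/
def odot {m p n : ℕ} (A : Matrix (Fin m) (Fin p) V) (B : Matrix (Fin p) (Fin n) W) :
    Matrix (Fin m) (Fin n) (AlgTensor V W) :=
  bilinProd (algTmul V W) A B

/-- The functional `f ⊗ g` on the algebraic tensor product. -/
def dualTensor (f : StrongDual ℂ V) (g : StrongDual ℂ W) : AlgTensor V W →ₗ[ℂ] ℂ :=
  TensorProduct.dualDistrib ℂ V W ((f : V →ₗ[ℂ] ℂ) ⊗ₜ (g : W →ₗ[ℂ] ℂ))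

lemma dualTensor_tmul (f : StrongDual ℂ V) (g : StrongDual ℂ W) (v : V) (w : W) :
    dualTensor f g (algTmul V W v w) = f v * g w := rfl

lemma eq_zero_of_dualTensor (t : AlgTensor V W)
    (h : ∀ (f : StrongDual ℂ V) (g : StrongDual ℂ W), dualTensor f g t = 0) : t = 0 := by
  classical
  let b := Module.Basis.ofVectorSpace ℂ V
  let e := TensorProduct.equivFinsuppOfBasisLeft (N := W) b
  have ht : t = (e t).sum fun i w => algTmul V W (b i) w := by
    conv_lhs => rw [← e.symm_apply_apply t]
    exact TensorProduct.equivFinsuppOfBasisLeft_symm_apply b _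
  have key (g : StrongDual ℂ W) (i) : g (e t i) = 0 := by
    have hv : (((e t).mapRange g (map_zero g)).sum fun i c => c • b i) = 0 := by
      refine SeparatingDual.eq_zero_of_forall_dual_eq_zero (R := ℂ) fun f => ?_
      rw [Finsupp.sum_mapRange_index (by simp), ← h f g]
      conv_rhs => rw [ht]
      simp [Finsupp.sum, dualTensor_tmul, mul_comm]
    have h3 := linearIndependent_iff.1 b.linearIndependent _ hv
    simpa using DFunLike.congr_fun h3 i
  have h0 : e t = 0 := by
    ext i
    exact SeparatingDual.eq_zero_of_forall_dual_eq_zero (R := ℂ) fun g => key g i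
  rw [ht, h0, Finsupp.sum_zero_index]

variable [MatrixNormedSpace V] [MatrixNormedSpace W]

/-- The values `∑ₗ ‖Aₗ‖ ‖Bₗ‖` over all finite decompositions `C = ∑ₗ Aₗ ⊙ Bₗ`. -/
def haagerupSet (C : Matrix (Fin m) (Fin n) (AlgTensor V W)) : Set ℝ :=
  {r | ∃ (ι : Type) (_ : Fintype ι) (q : ι → ℕ) (A : ∀ l, Matrix (Fin m) (Fin (q l)) V)
    (B : ∀ l, Matrix (Fin (q l)) (Fin n) W),
    C = ∑ l, odot (A l) (B l) ∧ r = ∑ l, mnorm (A l) * mnorm (B l)}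

/-- The Haagerup matrix-norm on `V ⊗ W`. -/
def haagerupNorm (C : Matrix (Fin m) (Fin n) (AlgTensor V W)) : ℝ := sInf (haagerupSet C)

lemma haagerupSet_nonneg {C : Matrix (Fin m) (Fin n) (AlgTensor V W)} {r : ℝ}
    (h : r ∈ haagerupSet C) : 0 ≤ r := by
  obtain ⟨ι, _, q, A, B, -, rfl⟩ := h
  exact Finset.sum_nonneg fun l _ => mul_nonneg (mnorm_nonneg _) (mnorm_nonneg _)

lemma haagerupSet_bddBelow (C : Matrix (Fin m) (Fin n) (AlgTensor V W)) :
    BddBelow (haagerupSet C) := ⟨0, fun _ => haagerupSet_nonneg⟩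

lemma haagerupSet_add {C D : Matrix (Fin m) (Fin n) (AlgTensor V W)} {r s : ℝ}
    (hr : r ∈ haagerupSet C) (hs : s ∈ haagerupSet D) : r + s ∈ haagerupSet (C + D) := by
  obtain ⟨ι, _, q, A, B, rfl, rfl⟩ := hr
  obtain ⟨κ, _, q', A', B', rfl, rfl⟩ := hs
  refine ⟨ι ⊕ κ, inferInstance, Sum.elim q q', fun l => match l with
    | .inl a => A a
    | .inr b => A' b, fun l => match l with
    | .inl a => B a
    | .inr b => B' b, ?_, ?_⟩ <;> rw [Fintype.sum_sum_type] <;> rfl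

lemma haagerupSet_odot {p : ℕ} (A : Matrix (Fin m) (Fin p) V) (B : Matrix (Fin p) (Fin n) W) :
    mnorm A * mnorm B ∈ haagerupSet (odot A B) :=
  ⟨Unit, inferInstance, fun _ => p, fun _ => A, fun _ => B, by simp, by simp⟩

lemma haagerupSet_zero : (0 : ℝ) ∈ haagerupSet (0 : Matrix (Fin m) (Fin n) (AlgTensor V W)) :=
  ⟨Empty, inferInstance, fun _ => 0, fun l => l.elim, fun l => l.elim, by simp, by simp⟩

lemma haagerupSet_nonempty (C : Matrix (Fin m) (Fin n) (AlgTensor V W)) :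
    (haagerupSet C).Nonempty := by
  have hsum {ι : Type} (s : Finset ι) (F : ι → Matrix (Fin m) (Fin n) (AlgTensor V W))
      (h : ∀ i, (haagerupSet (F i)).Nonempty) : (haagerupSet (∑ i ∈ s, F i)).Nonempty := by
    classical
    induction s using Finset.induction_on with
    | empty => exact ⟨0, by simpa using haagerupSet_zero⟩
    | insert a s ha ih =>
      rw [Finset.sum_insert ha]
      obtain ⟨r, hr⟩ := h a
      obtain ⟨t, ht⟩ := ih
      exact ⟨_, haagerupSet_add hr ht⟩
  rw [Matrix.matrix_eq_sum_single C]
  refine hsum _ _ fun i => hsum _ _ fun j => ?_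
  have key (t : V ⊗[ℂ] W) : (haagerupSet (m := m) (n := n)
      (Matrix.single i j (show AlgTensor V W from t))).Nonempty := by
    induction t using TensorProduct.induction_on with
    | zero => exact ⟨0, by convert haagerupSet_zero; exact Matrix.single_zero i j⟩
    | tmul v w =>
      have : Matrix.single i j (algTmul V W v w) =
          odot (Matrix.of fun a (_ : Fin 1) => if a = i then v else 0)
            (Matrix.of fun (_ : Fin 1) b => if b = j then w else 0) := by
        ext a b
        simp only [odot, bilinProd, Matrix.of_apply, Matrix.single_apply, Finset.univ_unique,
          Finset.sum_singleton]
        by_cases ha : a = i <;> by_cases hb : b = j <;> simp [ha, hb, eq_comm (a := i), eq_comm (a := j)]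
      change (haagerupSet (Matrix.single i j (algTmul V W v w))).Nonempty
      rw [this]
      exact ⟨_, haagerupSet_odot _ _⟩
    | add x y hx hy =>
      obtain ⟨r, hr⟩ := hx
      obtain ⟨s, hs⟩ := hy
      exact ⟨_, (Matrix.single_add i j x y) ▸ haagerupSet_add hr hs⟩
  exact key _

lemma haagerupNorm_nonneg (C : Matrix (Fin m) (Fin n) (AlgTensor V W)) : 0 ≤ haagerupNorm C :=
  Real.sInf_nonneg fun _ => haagerupSet_nonneg

lemma haagerupNorm_le {C : Matrix (Fin m) (Fin n) (AlgTensor V W)} {r : ℝ}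
    (h : r ∈ haagerupSet C) : haagerupNorm C ≤ r := csInf_le (haagerupSet_bddBelow C) h

lemma haagerupNorm_odot_le {p : ℕ} (A : Matrix (Fin m) (Fin p) V)
    (B : Matrix (Fin p) (Fin n) W) : haagerupNorm (odot A B) ≤ mnorm A * mnorm B :=
  haagerupNorm_le (haagerupSet_odot A B)

lemma haagerupNorm_add_le (C D : Matrix (Fin m) (Fin n) (AlgTensor V W)) :
    haagerupNorm (C + D) ≤ haagerupNorm C + haagerupNorm D := by
  refine le_of_forall_pos_le_add fun ε hε => ?_
  obtain ⟨r, hr, hr'⟩ := exists_lt_of_csInf_lt (haagerupSet_nonempty C)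
    (lt_add_of_pos_right (haagerupNorm C) (half_pos hε))
  obtain ⟨s, hs, hs'⟩ := exists_lt_of_csInf_lt (haagerupSet_nonempty D)
    (lt_add_of_pos_right (haagerupNorm D) (half_pos hε))
  linarith [haagerupNorm_le (haagerupSet_add hr hs)]

/-- An additive map between matrix spaces that sends each `A ⊙ B` to an element of norm at most
`K ‖A‖ ‖B‖` is bounded by `K` for the Haagerup norm. -/
lemma le_haagerupNorm {X : Type*} [AddCommGroup X] (N : X → ℝ) (hN0 : N 0 ≤ 0)
    (hN : ∀ x y, N (x + y) ≤ N x + N y) (K : ℝ) (hK : 0 ≤ K)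
    (F : Matrix (Fin m) (Fin n) (AlgTensor V W) →+ X)
    (hF : ∀ (p : ℕ) (A : Matrix (Fin m) (Fin p) V) (B : Matrix (Fin p) (Fin n) W),
      N (F (odot A B)) ≤ K * (mnorm A * mnorm B))
    (C : Matrix (Fin m) (Fin n) (AlgTensor V W)) : N (F C) ≤ K * haagerupNorm C := by
  have h : ∀ r ∈ haagerupSet C, N (F C) ≤ K * r := by
    rintro r ⟨ι, _, q, A, B, rfl, rfl⟩
    rw [map_sum, Finset.mul_sum]
    exact (Finset.le_sum_of_subadditive N hN0 hN _ _).trans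
      (Finset.sum_le_sum fun l _ => hF _ _ _)
  rcases hK.eq_or_lt with rfl | hK
  · obtain ⟨r, hr⟩ := haagerupSet_nonempty C
    simpa using h r hr
  · rw [← div_le_iff₀' hK]
    exact le_csInf (haagerupSet_nonempty C) fun r hr => (div_le_iff₀' hK).2 (h r hr)

lemma haagerupNorm_zero : haagerupNorm (0 : Matrix (Fin m) (Fin n) (AlgTensor V W)) = 0 :=
  le_antisymm (haagerupNorm_le haagerupSet_zero) (haagerupNorm_nonneg _)

lemma haagerupNorm_smul_le (c : ℂ) (C : Matrix (Fin m) (Fin n) (AlgTensor V W)) :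
    haagerupNorm (c • C) ≤ ‖c‖ * haagerupNorm C := by
  refine le_haagerupNorm haagerupNorm haagerupNorm_zero.le haagerupNorm_add_le ‖c‖ (norm_nonneg c)
    (DistribSMul.toAddMonoidHom _ c) (fun p A B => ?_) C
  have : c • odot A B = odot (c • A) B := by
    ext i j
    simp [odot, bilinProd, Finset.smul_sum]
  rw [DistribSMul.toAddMonoidHom_apply, this, ← mul_assoc, ← MatrixNormedSpace.mnorm_smul]
  exact haagerupNorm_odot_le _ _

lemma haagerupNorm_smul (c : ℂ) (C : Matrix (Fin m) (Fin n) (AlgTensor V W)) :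
    haagerupNorm (c • C) = ‖c‖ * haagerupNorm C := by
  refine le_antisymm (haagerupNorm_smul_le c C) ?_
  rcases eq_or_ne c 0 with rfl | hc
  · simpa using haagerupNorm_nonneg _
  · have h := haagerupNorm_smul_le c⁻¹ (c • C)
    rw [inv_smul_smul₀ hc, norm_inv] at h
    rwa [← div_eq_inv_mul, le_div_iff₀' (norm_pos_iff.2 hc)] at h

lemma haagerupNorm_mul_mul_le (A : Matrix (Fin k) (Fin m) ℂ)
    (C : Matrix (Fin m) (Fin n) (AlgTensor V W)) (B : Matrix (Fin n) (Fin l) ℂ) :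
    haagerupNorm (rmul (lmul A C) B) ≤ opNorm A * haagerupNorm C * opNorm B := by
  rw [mul_right_comm]
  refine le_haagerupNorm haagerupNorm haagerupNorm_zero.le haagerupNorm_add_le _
    (mul_nonneg (opNorm_nonneg _) (opNorm_nonneg _))
    (AddMonoidHom.mk' (fun C => rmul (lmul A C) B) fun C D => ?_) (fun p S T => ?_) C
  · ext i j
    simp [rmul, lmul, Finset.sum_add_distrib]
  · have : rmul (lmul A (odot S T)) B = odot (lmul A S) (rmul T B) := by
      ext i j
      simp only [rmul, lmul, odot, bilinProd, Matrix.of_apply, map_sum, LinearMap.sum_apply,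
        map_smul, LinearMap.smul_apply, Finset.smul_sum]
      rw [Finset.sum_congr rfl fun b _ => Finset.sum_comm, Finset.sum_comm]
    simp only [AddMonoidHom.mk'_apply]
    rw [this]
    refine (haagerupNorm_odot_le _ _).trans ?_
    calc _ ≤ (opNorm A * mnorm S) * (mnorm T * opNorm B) :=
          mul_le_mul (mnorm_lmul_le _ _) (mnorm_rmul_le _ _) (mnorm_nonneg _)
            (mul_nonneg (opNorm_nonneg _) (mnorm_nonneg _))
      _ = _ := by ring

lemma dualTensor_le (f : StrongDual ℂ V) (g : StrongDual ℂ W)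
    (C : Matrix (Fin 1) (Fin 1) (AlgTensor V W)) :
    ‖dualTensor f g (C 0 0)‖ ≤ ‖f‖ * ‖g‖ * haagerupNorm C := by
  refine le_haagerupNorm (fun z : ℂ => ‖z‖) norm_zero.le norm_add_le _ (by positivity)
    (AddMonoidHom.mk' (fun C : Matrix (Fin 1) (Fin 1) (AlgTensor V W) => dualTensor f g (C 0 0))
      fun C D => by simp) (fun p A B => ?_) C
  have h1 : dualTensor f g (odot A B 0 0) = ∑ j, f (A 0 j) * g (B j 0) := by
    simp [odot, bilinProd, dualTensor_tmul]
  simp only [AddMonoidHom.mk'_apply]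
  rw [h1]
  have hcs := Finset.sum_mul_sq_le_sq_mul_sq Finset.univ (fun j => ‖f (A 0 j)‖)
    (fun j => ‖g (B j 0)‖)
  rw [← opNorm_rowMat, ← opNorm_colMat, ← mul_pow] at hcs
  have hcs' := abs_le_of_sq_le_sq hcs (mul_nonneg (opNorm_nonneg _) (opNorm_nonneg _))
  calc ‖∑ j, f (A 0 j) * g (B j 0)‖ ≤ ∑ j, ‖f (A 0 j)‖ * ‖g (B j 0)‖ :=
        (norm_sum_le _ _).trans (Finset.sum_le_sum fun j _ => (norm_mul _ _).le)
    _ ≤ _ := (le_abs_self _).trans hcs'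
    _ ≤ (‖f‖ * mnorm A) * (‖g‖ * mnorm B) :=
      mul_le_mul (opNorm_dual_row f A) (opNorm_dual_col g B) (opNorm_nonneg _)
        (mul_nonneg (norm_nonneg _) (mnorm_nonneg _))
    _ = _ := by ring

lemma haagerupNorm_entry_le (C : Matrix (Fin m) (Fin n) (AlgTensor V W)) (i : Fin m)
    (j : Fin n) : haagerupNorm (Matrix.of fun (_ _ : Fin 1) => C i j) ≤ haagerupNorm C := by
  have h := haagerupNorm_mul_mul_le (rowMat (Pi.single i 1)) C (colMat (Pi.single j 1))
  rw [opNorm_rowMat_single, opNorm_colMat_single, one_mul, mul_one] at h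
  convert h using 2
  ext a b
  simp [rmul, lmul, rowMat, colMat, Pi.single_apply, ite_smul]

lemma eq_zero_of_haagerupNorm (C : Matrix (Fin m) (Fin n) (AlgTensor V W))
    (h : haagerupNorm C = 0) : C = 0 := by
  ext i j
  refine eq_zero_of_dualTensor _ fun f g => norm_le_zero_iff.1 ?_
  refine (dualTensor_le f g (Matrix.of fun _ _ => C i j)).trans ?_
  rw [le_antisymm ((haagerupNorm_entry_le C i j).trans h.le) (haagerupNorm_nonneg _), mul_zero]

lemma algTensor_core : @NormedSpace.Core ℂ (AlgTensor V W) _ _ _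
    ⟨fun t => haagerupNorm (Matrix.of fun (_ _ : Fin 1) => t)⟩ :=
  letI : Norm (AlgTensor V W) := ⟨fun t => haagerupNorm (Matrix.of fun (_ _ : Fin 1) => t)⟩
  { norm_nonneg := fun _ => haagerupNorm_nonneg _
    norm_smul := fun c t => haagerupNorm_smul c (Matrix.of fun (_ _ : Fin 1) => t)
    norm_triangle := fun s t => haagerupNorm_add_le (Matrix.of fun (_ _ : Fin 1) => s)
      (Matrix.of fun (_ _ : Fin 1) => t)
    norm_eq_zero_iff := fun t => ⟨fun h => congrFun (congrFun (eq_zero_of_haagerupNorm _ h) 0) 0,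
      fun h => by subst h; exact haagerupNorm_zero⟩ }

instance algTensorNormedAddCommGroup : NormedAddCommGroup (AlgTensor V W) :=
  letI : Norm (AlgTensor V W) := ⟨fun t => haagerupNorm (Matrix.of fun (_ _ : Fin 1) => t)⟩
  NormedAddCommGroup.ofCore algTensor_core

instance algTensorNormedSpace : NormedSpace ℂ (AlgTensor V W) where
  norm_smul_le c t := haagerupNorm_smul_le c (Matrix.of fun (_ _ : Fin 1) => t)

instance algTensorMatrixNormedSpace : MatrixNormedSpace (AlgTensor V W) where
  mnorm := haagerupNorm
  mnorm_add_le := haagerupNorm_add_le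
  mnorm_smul := haagerupNorm_smul
  eq_zero_of_mnorm := eq_zero_of_haagerupNorm
  mnorm_mul_mul_le := haagerupNorm_mul_mul_le
  mnorm_single _ := rfl

variable (V W) in
/-- The Haagerup tensor product `V ⊗_h W`: the completion of `V ⊗ W` for the Haagerup
matrix-norm. -/
abbrev HaagerupTensor : Type max u v := UniformSpace.Completion (AlgTensor V W)

end Haagerup

section Bilinear

open UniformSpace

/-- A completely contractive linear map between matrix-normed spaces. -/
def IsCompletelyContractive {X : Type u} {Y : Type v} [NormedAddCommGroup X] [NormedSpace ℂ X]
    [MatrixNormedSpace X] [NormedAddCommGroup Y] [NormedSpace ℂ Y] [MatrixNormedSpace Y]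
    (φ : X →ₗ[ℂ] Y) : Prop :=
  ∀ (m n : ℕ) (A : Matrix (Fin m) (Fin n) X), mnorm (A.map φ) ≤ mnorm A

variable {X : Type u} {Y : Type v} {Z : Type w}
  [NormedAddCommGroup X] [NormedSpace ℂ X] [MatrixNormedSpace X]
  [NormedAddCommGroup Y] [NormedSpace ℂ Y] [MatrixNormedSpace Y]
  [NormedAddCommGroup Z] [NormedSpace ℂ Z] [MatrixNormedSpace Z]

/-- A completely contractive bilinear map: `‖A ⊙_φ B‖ ≤ ‖A‖ ‖B‖` for all matrices. -/
def IsCCBilinear (φ : X →ₗ[ℂ] Y →ₗ[ℂ] Z) : Prop :=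
  ∀ (m p n : ℕ) (A : Matrix (Fin m) (Fin p) X) (B : Matrix (Fin p) (Fin n) Y),
    mnorm (bilinProd φ A B) ≤ mnorm A * mnorm B

variable (X Y) in
/-- The canonical bilinear map `(x, y) ↦ x ⊗ y` into the Haagerup tensor product. -/
def tmul : X →ₗ[ℂ] Y →ₗ[ℂ] HaagerupTensor X Y :=
  (algTmul X Y).compr₂ (Completion.toComplL (𝕜 := ℂ) (E := AlgTensor X Y) :
    AlgTensor X Y →ₗ[ℂ] HaagerupTensor X Y)

lemma tmul_apply (x : X) (y : Y) :
    tmul X Y x y = ((algTmul X Y x y : AlgTensor X Y) : HaagerupTensor X Y) := rfl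

lemma bilinProd_tmul {m p n : ℕ} (A : Matrix (Fin m) (Fin p) X) (B : Matrix (Fin p) (Fin n) Y) :
    bilinProd (tmul X Y) A B = coeMat (odot A B) := by
  ext i j
  simp only [bilinProd, odot, coeMat, Matrix.of_apply, Matrix.map_apply, tmul_apply,
    ← Completion.coe_toComplL (𝕜 := ℂ), map_sum]

lemma isCCBilinear_tmul : IsCCBilinear (tmul X Y) := by
  intro m p n A B
  rw [bilinProd_tmul]
  exact (completionNorm_coe _).trans_le (haagerupNorm_odot_le A B)

variable (V : Type u) [NormedAddCommGroup V] [NormedSpace ℂ V] [MatrixNormedSpace V]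

/-- Given a bilinear `β : X × Y → Z`, the bilinear map `X × (Y ⊗ V) → Z ⊗_h V` with
`(x, y ⊗ v) ↦ β(x, y) ⊗ v`. -/
def algExtend (β : X →ₗ[ℂ] Y →ₗ[ℂ] Z) : X →ₗ[ℂ] AlgTensor Y V →ₗ[ℂ] HaagerupTensor Z V :=
  LinearMap.mk₂ ℂ (fun x t => TensorProduct.lift ((tmul Z V).comp (β x)) t)
    (fun x x' t => by
      have h : TensorProduct.lift ((tmul Z V).comp (β (x + x'))) =
          TensorProduct.lift ((tmul Z V).comp (β x)) +
            TensorProduct.lift ((tmul Z V).comp (β x')) :=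
        TensorProduct.ext' fun y v => by simp
      exact DFunLike.congr_fun h t)
    (fun c x t => by
      have h : TensorProduct.lift ((tmul Z V).comp (β (c • x))) =
          c • TensorProduct.lift ((tmul Z V).comp (β x)) :=
        TensorProduct.ext' fun y v => by simp
      exact DFunLike.congr_fun h t)
    (fun x t t' => map_add _ _ _) (fun c x t => map_smul _ _ _)

variable {V}

lemma algExtend_tmul (β : X →ₗ[ℂ] Y →ₗ[ℂ] Z) (x : X) (y : Y) (v : V) :
    algExtend V β x (algTmul Y V y v) = tmul Z V (β x y) v := by
  exact TensorProduct.lift.tmul _ _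

lemma bilinProd_algExtend {β : X →ₗ[ℂ] Y →ₗ[ℂ] Z} {m p q n : ℕ} (A : Matrix (Fin m) (Fin p) X)
    (S : Matrix (Fin p) (Fin q) Y) (T : Matrix (Fin q) (Fin n) V) :
    bilinProd (algExtend V β) A (odot S T) = bilinProd (tmul Z V) (bilinProd β A S) T := by
  ext i j
  simp only [bilinProd, odot, Matrix.of_apply, map_sum, algExtend_tmul, LinearMap.sum_apply]
  exact Finset.sum_comm

lemma algExtend_cc {β : X →ₗ[ℂ] Y →ₗ[ℂ] Z} (hβ : IsCCBilinear β) :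
    IsCCBilinear (algExtend V β) := by
  intro m p n A C
  refine le_haagerupNorm mnorm mnorm_zero.le MatrixNormedSpace.mnorm_add_le _ (mnorm_nonneg A)
    (AddMonoidHom.mk' (fun C => bilinProd (algExtend V β) A C) fun C D => ?_)
    (fun q S T => ?_) C
  · ext i j
    simp [bilinProd, Finset.sum_add_distrib]
  · simp only [AddMonoidHom.mk'_apply]
    rw [bilinProd_algExtend, ← mul_assoc]
    exact (isCCBilinear_tmul _ _ _ _ _).trans
      (mul_le_mul_of_nonneg_right (hβ _ _ _ _ _) (mnorm_nonneg _))

lemma IsCCBilinear.norm_le {β : X →ₗ[ℂ] Y →ₗ[ℂ] Z} (hβ : IsCCBilinear β) (x : X) (y : Y) :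
    ‖β x y‖ ≤ ‖x‖ * ‖y‖ := by
  have h := hβ 1 1 1 (Matrix.of fun _ _ => x) (Matrix.of fun _ _ => y)
  rw [MatrixNormedSpace.mnorm_single, MatrixNormedSpace.mnorm_single] at h
  refine le_trans (le_of_eq ?_) h
  rw [← MatrixNormedSpace.mnorm_single]
  congr 1
  ext i j
  simp [bilinProd]

/-- A completely contractive bilinear map as a bounded bilinear map. -/
def IsCCBilinear.toCLM {β : X →ₗ[ℂ] Y →ₗ[ℂ] Z} (hβ : IsCCBilinear β) : X →L[ℂ] Y →L[ℂ] Z :=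
  LinearMap.mkContinuous₂ β 1 fun x y => by rw [one_mul]; exact hβ.norm_le x y

/-- The bounded linear extension of `t ↦ algExtend V β x t` to the completion `Y ⊗_h V`. -/
def tensorExtendAux {β : X →ₗ[ℂ] Y →ₗ[ℂ] Z} (hβ : IsCCBilinear β) (x : X) :
    HaagerupTensor Y V →L[ℂ] HaagerupTensor Z V :=
  ((algExtend_cc (V := V) hβ).toCLM x).extend
    (Completion.toComplL (𝕜 := ℂ) (E := AlgTensor Y V))

lemma tensorExtendAux_coe {β : X →ₗ[ℂ] Y →ₗ[ℂ] Z} (hβ : IsCCBilinear β) (x : X)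
    (t : AlgTensor Y V) :
    tensorExtendAux hβ x (t : HaagerupTensor Y V) = algExtend V β x t :=
  ContinuousLinearMap.extend_eq _ (e := Completion.toComplL (𝕜 := ℂ) (E := AlgTensor Y V))
    Completion.denseRange_coe (Completion.isUniformInducing_coe _) t

/-- The bilinear map `X × (Y ⊗_h V) → Z ⊗_h V`, continuous in the second variable, with
`(x, y ⊗ v) ↦ β(x, y) ⊗ v`. -/
def tensorExtend {β : X →ₗ[ℂ] Y →ₗ[ℂ] Z} (hβ : IsCCBilinear β) :
    X →ₗ[ℂ] HaagerupTensor Y V →ₗ[ℂ] HaagerupTensor Z V :=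
  LinearMap.mk₂ ℂ (fun x t => tensorExtendAux hβ x t)
    (fun x x' t => by
      induction t using Completion.induction_on with
      | hp => exact isClosed_eq (map_continuous _) ((map_continuous _).add (map_continuous _))
      | ih t => simp only [tensorExtendAux_coe, map_add, LinearMap.add_apply])
    (fun c x t => by
      induction t using Completion.induction_on with
      | hp => exact isClosed_eq (map_continuous _) ((map_continuous _).const_smul c)
      | ih t => simp only [tensorExtendAux_coe, map_smul, LinearMap.smul_apply])
    (fun _ _ _ => map_add _ _ _) (fun _ _ _ => map_smul _ _ _)

lemma tensorExtend_tmul {β : X →ₗ[ℂ] Y →ₗ[ℂ] Z} (hβ : IsCCBilinear β) (x : X) (y : Y) (v : V) :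
    tensorExtend hβ x (tmul Y V y v) = tmul Z V (β x y) v :=
  (tensorExtendAux_coe hβ x _).trans (algExtend_tmul β x y v)

lemma tensorExtend_cc {β : X →ₗ[ℂ] Y →ₗ[ℂ] Z} (hβ : IsCCBilinear β) :
    IsCCBilinear (tensorExtend (V := V) hβ) := by
  intro m p n A B
  refine denseRange_coeMat.induction_on (p := fun B => mnorm (bilinProd (tensorExtend hβ) A B) ≤
    mnorm A * mnorm B) B ?_ fun B => ?_
  · refine isClosed_le (continuous_completionNorm.comp (continuous_matrix fun i j => ?_))
      (continuous_const.mul continuous_completionNorm)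
    have h (a : Fin p) : Continuous fun B : Matrix (Fin p) (Fin n) (HaagerupTensor Y V) =>
        tensorExtendAux hβ (A i a) (B a j) :=
      (map_continuous (tensorExtendAux hβ (A i a))).comp (continuous_id.matrix_elem a j)
    change Continuous fun B : Matrix (Fin p) (Fin n) (HaagerupTensor Y V) =>
      ∑ a, tensorExtendAux hβ (A i a) (B a j)
    exact continuous_finsetSum _ fun a _ => h a
  · have h : bilinProd (tensorExtend hβ) A (coeMat B) = bilinProd (algExtend V β) A B := by
      ext i j
      change ∑ a, tensorExtendAux hβ (A i a) (B a j : HaagerupTensor Y V) =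
        ∑ a, algExtend V β (A i a) (B a j)
      exact Finset.sum_congr rfl fun a _ => tensorExtendAux_coe hβ (A i a) (B a j)
    rw [h]
    exact (algExtend_cc hβ _ _ _ A B).trans_eq (congrArg _ (completionNorm_coe B).symm)

end Bilinear

section DirectSum

open scoped ENNReal

variable {ι : Type v} {E : ι → Type u} [∀ i, NormedAddCommGroup (E i)]
  [∀ i, NormedSpace ℂ (E i)] {m n : ℕ}

/-- The canonical projection `π_i` of the `ℓ¹`-direct sum. -/
def lpProj (i : ι) : lp E 1 →ₗ[ℂ] E i where
  toFun x := x i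
  map_add' _ _ := rfl
  map_smul' _ _ := rfl

/-- The matrix `M_{m,n}(π_i)(A)` of `i`-th coordinates. -/
def coordMat (A : Matrix (Fin m) (Fin n) (lp E 1)) (i : ι) : Matrix (Fin m) (Fin n) (E i) :=
  A.map (lpProj i)

lemma lp_summable_norm (x : lp E 1) : Summable fun i => ‖x i‖ := by
  simpa using (lp.memℓp x).summable (by simp)

variable [∀ i, MatrixNormedSpace (E i)]

/-- The `ℓ¹`-sum matrix-norm on the `ℓ¹`-direct sum. -/
def sumNorm (A : Matrix (Fin m) (Fin n) (lp E 1)) : ℝ := ∑' i, mnorm (coordMat A i)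

lemma summable_coordMat (A : Matrix (Fin m) (Fin n) (lp E 1)) :
    Summable fun i => mnorm (coordMat A i) :=
  Summable.of_nonneg_of_le (fun _ => mnorm_nonneg _) (fun _ => mnorm_le_sum _)
    (summable_sum fun a _ => summable_sum fun b _ => lp_summable_norm (A a b))

instance directSumMatrixNormedSpace : MatrixNormedSpace (lp E 1) where
  mnorm := sumNorm
  mnorm_add_le A B := by
    unfold sumNorm
    rw [← (summable_coordMat A).tsum_add (summable_coordMat B)]
    exact (summable_coordMat _).tsum_le_tsum
      (fun i => MatrixNormedSpace.mnorm_add_le (coordMat A i) (coordMat B i))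
      ((summable_coordMat A).add (summable_coordMat B))
  mnorm_smul c A := by
    unfold sumNorm
    rw [← tsum_mul_left]
    exact tsum_congr fun i => MatrixNormedSpace.mnorm_smul c (coordMat A i)
  eq_zero_of_mnorm A h := by
    have h' := (hasSum_zero_iff_of_nonneg fun i => mnorm_nonneg (coordMat A i)).1
      ((summable_coordMat A).hasSum_iff.2 h)
    ext a b i
    exact congrFun (congrFun (MatrixNormedSpace.eq_zero_of_mnorm _ (congrFun h' i)) a) b
  mnorm_mul_mul_le {k m n l} S A T := by
    unfold sumNorm
    rw [mul_right_comm, ← tsum_mul_left]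
    refine (summable_coordMat _).tsum_le_tsum (fun i => ?_) ((summable_coordMat A).mul_left _)
    have : coordMat (rmul (lmul S A) T) i = rmul (lmul S (coordMat A i)) T := by
      ext a b
      simp [coordMat, rmul, lmul, map_sum]
    rw [this, mul_right_comm]
    exact MatrixNormedSpace.mnorm_mul_mul_le _ _ _
  mnorm_single x := by
    rw [lp.norm_eq_tsum_rpow (by simp)]
    simp only [ENNReal.toReal_one, Real.rpow_one, div_one]
    exact tsum_congr fun i => MatrixNormedSpace.mnorm_single (x i)

end DirectSum

section TensorAlgebra

/-- A matricial Banach space: a complete matrix-normed space. -/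
structure MatBanSpace where
  carrier : Type u
  [normedAddCommGroup : NormedAddCommGroup carrier]
  [normedSpace : NormedSpace ℂ carrier]
  [matrixNormedSpace : MatrixNormedSpace carrier]
  [completeSpace : CompleteSpace carrier]

attribute [instance] MatBanSpace.normedAddCommGroup MatBanSpace.normedSpace
  MatBanSpace.matrixNormedSpace MatBanSpace.completeSpace

variable (V : Type u) [NormedAddCommGroup V] [NormedSpace ℂ V] [MatrixNormedSpace V]
  [CompleteSpace V]

/-- The Haagerup tensor powers with shifted index: `haagerupPowAux V n = V^{⊗_h (n+1)}`. -/
def haagerupPowAux : ℕ → MatBanSpace.{u}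
  | 0 => ⟨V⟩
  | n + 1 => ⟨HaagerupTensor (haagerupPowAux n).carrier V⟩

/-- The Haagerup tensor power `V^{⊗_h (n+1)}`, so `HaagerupPow V 0 = V` and
`HaagerupPow V (n + 1) = HaagerupPow V n ⊗_h V`. -/
abbrev HaagerupPow (n : ℕ) : Type u := (haagerupPowAux V n).carrier

/-- The canonical completely contractive bilinear maps
`V^{⊗_h (a+1)} × V^{⊗_h (b+1)} → V^{⊗_h (a+b+2)}`, determined by `(x, v) ↦ x ⊗ v` for `b = 0`
and `(x, y ⊗ v) ↦ (x · y) ⊗ v`. -/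
def powMulAux (a : ℕ) : (b : ℕ) →
    {β : HaagerupPow V a →ₗ[ℂ] HaagerupPow V b →ₗ[ℂ] HaagerupPow V (a + b + 1) //
      IsCCBilinear β}
  | 0 => ⟨tmul (HaagerupPow V a) V, isCCBilinear_tmul⟩
  | b + 1 => ⟨tensorExtend (V := V) (powMulAux a b).2, tensorExtend_cc (powMulAux a b).2⟩

/-- The canonical bilinear map `V^{⊗_h (a+1)} × V^{⊗_h (b+1)} → V^{⊗_h (a+b+2)}`. -/
def powMul (a b : ℕ) : HaagerupPow V a →ₗ[ℂ] HaagerupPow V b →ₗ[ℂ] HaagerupPow V (a + b + 1) :=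
  (powMulAux V a b).1

/-- The underlying matricial Banach space of the Haagerup tensor algebra: the matricial
`ℓ¹`-direct sum of the Haagerup tensor powers `V^{⊗_h 1}, V^{⊗_h 2}, …`. -/
abbrev HaagerupTensorAlgebra : Type u := lp (fun n : ℕ => HaagerupPow V n) 1

variable {V}

/-- The product on the Haagerup tensor algebra, `x y = ∑_{a,b} x_a · y_b`, where the term
`x_a · y_b` lies in the summand `V^{⊗_h (a+b+2)}`. -/
instance haagerupMul : Mul (HaagerupTensorAlgebra V) :=
  ⟨fun x y => ∑' p : ℕ × ℕ, lp.single 1 (p.1 + p.2 + 1) (powMul V p.1 p.2 (x p.1) (y p.2))⟩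

variable (V) in
/-- The inclusion of `V` as the first tensor power. -/
def tensorInclusion : V →ₗ[ℂ] HaagerupTensorAlgebra V :=
  (lp.singleContinuousLinearMap ℂ (fun n : ℕ => HaagerupPow V n) 1 0 :
    HaagerupPow V 0 →ₗ[ℂ] HaagerupTensorAlgebra V)

end TensorAlgebra

/-- A matricial Banach algebra: a complete matrix-normed space with an associative bilinear
product (not necessarily unital) such that `‖A B‖ ≤ ‖A‖ ‖B‖` for all matrices of compatible
sizes. -/
structure IsMatricialBanachAlgebra (A : Type u) [NormedAddCommGroup A] [NormedSpace ℂ A]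
    [MatrixNormedSpace A] [Mul A] : Prop where
  complete : CompleteSpace A
  mul_assoc : ∀ x y z : A, x * y * z = x * (y * z)
  add_mul : ∀ x y z : A, (x + y) * z = x * z + y * z
  mul_add : ∀ x y z : A, x * (y + z) = x * y + x * z
  smul_mul : ∀ (c : ℂ) (x y : A), (c • x) * y = c • (x * y)
  mul_smul : ∀ (c : ℂ) (x y : A), x * (c • y) = c • (x * y)
  mnorm_mul_le : ∀ {m p n : ℕ} (S : Matrix (Fin m) (Fin p) A) (T : Matrix (Fin p) (Fin n) A),
    mnorm (S * T) ≤ mnorm S * mnorm T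

end

end MatricialBanach

namespace MatricialBanach

noncomputable section

open Filter Topology UniformSpace
open scoped TensorProduct ENNReal

universe u v w

open MatrixNormedSpace (mnorm)

/-! ### Matrix norms of infinite sums; boundedness of completely contractive maps. -/

section MatrixNorm

variable {V : Type u} [NormedAddCommGroup V] [NormedSpace ℂ V] [MatrixNormedSpace V] {m n : ℕ}

/-! Every norm estimate comes from complete contractivity one tensor degree at a time, and every
algebraic identity from the fact that `V` generates the algebra under right multiplication.

For the norms: matrices whose entries come from `x_a · y_b` have norm at most `‖π_a S‖ ‖π_b T‖`, and
summing over all pairs gives exactly `‖S‖ ‖T‖`, since the algebra carries the `ℓ¹` norm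
(`mulLinear_cc`). On the target side, a completely contractive bilinear map factors through the
Haagerup tensor product (`haagerupLift_cc`). Hence `(s, v) ↦ ψ_n s * φ v` yields `ψ_{n+1}` from
`ψ_n`, and the sum of the `ψ_n` is completely contractive, again by the `ℓ¹` norm
(`algebraLift_cc`).

For the identities: an elementary tensor `s ⊗ v` is the product `s * v` (`powInclusion_powTmul`), so
a bounded linear map is controlled by its values on `V` and by passing from `x` to `x * v`
(`haagerupTensorAlgebra_induction`). Associativity and multiplicativity are first proved with last
factor in `V`, where they are the defining recursions, and then extended by this induction.
Uniqueness follows from the same induction. -/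

/-- The matrix norm is continuous for entrywise convergence, so the triangle inequality for finite
partial sums passes to the limit. -/
lemma mnorm_le_of_hasSum {ι : Type*} {f : ι → Matrix (Fin m) (Fin n) V}
    {A : Matrix (Fin m) (Fin n) V} {g : ι → ℝ} {c : ℝ} (hf : HasSum f A) (hg : HasSum g c)
    (hfg : ∀ i, mnorm (f i) ≤ g i) : mnorm A ≤ c :=
  le_of_tendsto_of_tendsto' ((uniformContinuous_mnorm.continuous.tendsto A).comp hf) hg
    fun s => (mnorm_sum_le s f).trans (Finset.sum_le_sum fun i _ => hfg i)

lemma hasSum_matrix {ι : Type*} {f : ι → Matrix (Fin m) (Fin n) V}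
    {A : Matrix (Fin m) (Fin n) V} (h : ∀ i j, HasSum (fun k => f k i j) (A i j)) :
    HasSum f A :=
  Pi.hasSum.2 fun i => Pi.hasSum.2 fun j => h i j

variable {W : Type v} [NormedAddCommGroup W] [NormedSpace ℂ W] [MatrixNormedSpace W]

lemma IsCompletelyContractive.norm_le {φ : V →ₗ[ℂ] W} (hφ : IsCompletelyContractive φ) (x : V) :
    ‖φ x‖ ≤ ‖x‖ := by
  rw [← MatrixNormedSpace.mnorm_single, ← MatrixNormedSpace.mnorm_single]
  exact hφ 1 1 (Matrix.of fun _ _ => x)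

/-- A completely contractive linear map as a bounded linear map. -/
def IsCompletelyContractive.toCLM {φ : V →ₗ[ℂ] W} (hφ : IsCompletelyContractive φ) :
    V →L[ℂ] W :=
  φ.mkContinuous 1 fun x => by rw [one_mul]; exact hφ.norm_le x

end MatrixNorm

/-! ### The universal property of the Haagerup tensor product. -/

section Lift

variable {X : Type u} {Y : Type v} {Z : Type w}
  [NormedAddCommGroup X] [NormedSpace ℂ X] [MatrixNormedSpace X]
  [NormedAddCommGroup Y] [NormedSpace ℂ Y] [MatrixNormedSpace Y]
  [NormedAddCommGroup Z] [NormedSpace ℂ Z]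

/-- Elementary tensors span the algebraic tensor product, which is dense in its completion. -/
lemma haagerupTensor_ext {f g : HaagerupTensor X Y →L[ℂ] Z}
    (h : ∀ x y, f (tmul X Y x y) = g (tmul X Y x y)) : f = g := by
  refine ContinuousLinearMap.ext fun t => ?_
  induction t using Completion.induction_on with
  | hp => exact isClosed_eq f.continuous g.continuous
  | ih t =>
    let e := Completion.toComplL (𝕜 := ℂ) (E := AlgTensor X Y)
    have key : ((f : HaagerupTensor X Y →ₗ[ℂ] Z) ∘ₗ (e : AlgTensor X Y →ₗ[ℂ] _) :
          X ⊗[ℂ] Y →ₗ[ℂ] Z) =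
        (g : HaagerupTensor X Y →ₗ[ℂ] Z) ∘ₗ (e : AlgTensor X Y →ₗ[ℂ] _) :=
      TensorProduct.ext' h
    exact DFunLike.congr_fun key t

variable [MatrixNormedSpace Z]

/-- The linear map on the algebraic tensor product induced by a bilinear map. -/
def algLift (β : X →ₗ[ℂ] Y →ₗ[ℂ] Z) : AlgTensor X Y →ₗ[ℂ] Z := TensorProduct.lift β

lemma algLift_tmul (β : X →ₗ[ℂ] Y →ₗ[ℂ] Z) (x : X) (y : Y) :
    algLift β (algTmul X Y x y) = β x y := TensorProduct.lift.tmul _ _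

/-- Entrywise, the lift carries `odot A B` to `bilinProd β A B`. The bound on `β` therefore applies
to each term of a decomposition, and `le_haagerupNorm` with constant 1 passes to the infimum. -/
lemma algLift_cc {β : X →ₗ[ℂ] Y →ₗ[ℂ] Z} (hβ : IsCCBilinear β) :
    IsCompletelyContractive (algLift β) := by
  intro m n C
  have h := le_haagerupNorm mnorm mnorm_zero.le MatrixNormedSpace.mnorm_add_le 1 zero_le_one
    ((algLift β).toAddMonoidHom.mapMatrix) (fun p A B => ?_) C
  · rwa [one_mul] at h
  · rw [one_mul]
    refine le_of_eq_of_le (congrArg mnorm ?_) (hβ m p n A B)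
    ext i j
    simp [odot, bilinProd, algLift_tmul]

variable [CompleteSpace Z]

/-- The bounded linear map on the Haagerup tensor product induced by a completely contractive
bilinear map into a complete space. -/
def haagerupLift {β : X →ₗ[ℂ] Y →ₗ[ℂ] Z} (hβ : IsCCBilinear β) : HaagerupTensor X Y →L[ℂ] Z :=
  (algLift_cc hβ).toCLM.extend (Completion.toComplL (𝕜 := ℂ) (E := AlgTensor X Y))

lemma haagerupLift_coe {β : X →ₗ[ℂ] Y →ₗ[ℂ] Z} (hβ : IsCCBilinear β) (t : AlgTensor X Y) :
    haagerupLift hβ (t : HaagerupTensor X Y) = algLift β t :=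
  ContinuousLinearMap.extend_eq _ (e := Completion.toComplL (𝕜 := ℂ) (E := AlgTensor X Y))
    Completion.denseRange_coe (Completion.isUniformInducing_coe _) t

lemma haagerupLift_tmul {β : X →ₗ[ℂ] Y →ₗ[ℂ] Z} (hβ : IsCCBilinear β) (x : X) (y : Y) :
    haagerupLift hβ (tmul X Y x y) = β x y :=
  (haagerupLift_coe hβ _).trans (algLift_tmul β x y)

lemma haagerupLift_cc {β : X →ₗ[ℂ] Y →ₗ[ℂ] Z} (hβ : IsCCBilinear β) :
    IsCompletelyContractive (haagerupLift hβ : HaagerupTensor X Y →ₗ[ℂ] Z) := by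
  intro m n A
  refine denseRange_coeMat.induction_on (p := fun A => mnorm (A.map (haagerupLift hβ)) ≤
    mnorm A) A ?_ fun A => ?_
  -- Both norms are continuous in the entries, so the estimate only has to be checked on the dense
  -- set of matrices over the algebraic tensor product.
  · exact isClosed_le (uniformContinuous_mnorm.continuous.comp
      (continuous_id.matrix_map (map_continuous (haagerupLift hβ)))) continuous_completionNorm
  · have h : (coeMat A).map (haagerupLift hβ) = A.map (algLift β) := by
      ext i j
      exact haagerupLift_coe hβ (A i j)
    rw [h]
    exact (algLift_cc hβ _ _ A).trans_eq (completionNorm_coe A).symm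

end Lift

/-! ### Isometric inclusion of a summand in the `ℓ¹`-sum. -/

section DirectSum

variable {ι : Type v} {E : ι → Type u} [∀ i, NormedAddCommGroup (E i)]
  [∀ i, NormedSpace ℂ (E i)] [∀ i, MatrixNormedSpace (E i)] {m n : ℕ}

lemma hasSum_coordMat (A : Matrix (Fin m) (Fin n) (lp E 1)) :
    HasSum (fun i => mnorm (coordMat A i)) (mnorm A) := (summable_coordMat A).hasSum

/-- Only the `i`-th term of the series defining the `ℓ¹` matrix norm is nonzero. -/
lemma mnorm_map_single [DecidableEq ι] (i : ι) (A : Matrix (Fin m) (Fin n) (E i)) :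
    mnorm (A.map (lp.lsingle (𝕜 := ℂ) (E := E) 1 i)) = mnorm A := by
  refine (hasSum_coordMat _).unique ?_
  convert hasSum_single i fun j hj => ?_ using 2
  · ext a b
    exact (lp.single_apply_self (E := E) 1 i (A a b)).symm
  · have : coordMat (A.map (lp.lsingle (𝕜 := ℂ) (E := E) 1 i)) j = 0 := by
      ext a b
      exact lp.single_apply_ne (E := E) 1 i (A a b) hj
    rw [this, mnorm_zero]

end DirectSum

/-! ### The product of the tensor algebra and its norm estimate. -/

section Product

variable {V : Type u} [NormedAddCommGroup V] [NormedSpace ℂ V] [MatrixNormedSpace V]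
  [CompleteSpace V] {m n p : ℕ}

variable (V) in
/-- The term `x_a · y_b` of the product `x y`, in the summand `V^{⊗_h (a+b+2)}`. -/
def mulTerm (a b : ℕ) : HaagerupTensorAlgebra V →ₗ[ℂ] HaagerupTensorAlgebra V →ₗ[ℂ]
    HaagerupTensorAlgebra V :=
  ((powMul V a b).compl₁₂ (lpProj a) (lpProj b)).compr₂
    (lp.lsingle (𝕜 := ℂ) (E := fun n => HaagerupPow V n) 1 (a + b + 1))

lemma mulTerm_apply (a b : ℕ) (x y : HaagerupTensorAlgebra V) :
    mulTerm V a b x y = lp.single 1 (a + b + 1) (powMul V a b (x a) (y b)) := rfl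

/-- The matrix on the left is supported in the single degree `a + b + 1`, where it is the
`powMul`-product of the coordinate matrices; the inclusion of that degree is isometric and `powMul`
is completely contractive. -/
lemma mnorm_bilinProd_mulTerm_le (a b : ℕ)
    (S : Matrix (Fin m) (Fin p) (HaagerupTensorAlgebra V))
    (T : Matrix (Fin p) (Fin n) (HaagerupTensorAlgebra V)) :
    mnorm (bilinProd (mulTerm V a b) S T) ≤ mnorm (coordMat S a) * mnorm (coordMat T b) := by
  have h : bilinProd (mulTerm V a b) S T =
      (bilinProd (powMul V a b) (coordMat S a) (coordMat T b)).map
        (lp.lsingle (𝕜 := ℂ) (E := fun n => HaagerupPow V n) 1 (a + b + 1)) := by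
    ext1 i j
    simp only [bilinProd, Matrix.of_apply, Matrix.map_apply, map_sum]
    rfl
  rw [h, mnorm_map_single]
  exact (powMulAux V a b).2 _ _ _ _ _

lemma hasSum_mul_of_nonneg {f g : ℕ → ℝ} {r s : ℝ} (hf : HasSum f r) (hg : HasSum g s)
    (hf' : 0 ≤ f) (hg' : 0 ≤ g) : HasSum (fun q : ℕ × ℕ => f q.1 * g q.2) (r * s) :=
  hf.mul hg (hf.summable.mul_of_nonneg hg.summable hf' hg')

lemma hasSum_mnorm_mul (S : Matrix (Fin m) (Fin p) (HaagerupTensorAlgebra V))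
    (T : Matrix (Fin p) (Fin n) (HaagerupTensorAlgebra V)) :
    HasSum (fun q : ℕ × ℕ => mnorm (coordMat S q.1) * mnorm (coordMat T q.2))
      (mnorm S * mnorm T) :=
  hasSum_mul_of_nonneg (f := fun i => mnorm (coordMat S i))
    (g := fun i => mnorm (coordMat T i)) (hasSum_coordMat S) (hasSum_coordMat T)
    (fun _ => mnorm_nonneg _) fun _ => mnorm_nonneg _

/-- The product is a `tsum`, which would be 0 by default without summability. Here the double series
converges absolutely, dominated by `‖x_a‖ ‖y_b‖`; bilinearity then follows from uniqueness of sums.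
-/
lemma hasSum_mul (x y : HaagerupTensorAlgebra V) :
    HasSum (fun q : ℕ × ℕ => mulTerm V q.1 q.2 x y) (x * y) := by
  have h (z : HaagerupTensorAlgebra V) : Summable fun i => ‖z i‖ := lp_summable_norm z
  have h2 : Summable fun q : ℕ × ℕ => ‖x q.1‖ * ‖y q.2‖ :=
    (h x).mul_of_nonneg (h y) (fun _ => norm_nonneg _) fun _ => norm_nonneg _
  refine (Summable.of_norm_bounded h2 fun q => ?_).hasSum
  rw [mulTerm_apply, lp.norm_single (by simp)]
  exact (powMulAux V q.1 q.2).2.norm_le _ _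

variable (V) in
/-- The product of the Haagerup tensor algebra as a bilinear map. -/
def mulLinear : HaagerupTensorAlgebra V →ₗ[ℂ] HaagerupTensorAlgebra V →ₗ[ℂ]
    HaagerupTensorAlgebra V :=
  LinearMap.mk₂ ℂ (fun x y => x * y)
    (fun x x' y => (hasSum_mul _ _).unique <| by
      simpa only [map_add, LinearMap.add_apply] using (hasSum_mul x y).add (hasSum_mul x' y))
    (fun c x y => (hasSum_mul _ _).unique <| by
      simpa only [map_smul, LinearMap.smul_apply] using (hasSum_mul x y).const_smul c)
    (fun x y y' => (hasSum_mul _ _).unique <| by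
      simpa only [map_add] using (hasSum_mul x y).add (hasSum_mul x y'))
    (fun c x y => (hasSum_mul _ _).unique <| by
      simpa only [map_smul] using (hasSum_mul x y).const_smul c)

/-- The matrix product is the sum of its parts over pairs of degrees, and the bounds on these parts
sum to the product of the two `ℓ¹` norms. -/
lemma mulLinear_cc : IsCCBilinear (mulLinear V) := by
  intro m p n S T
  refine mnorm_le_of_hasSum (f := fun q : ℕ × ℕ => bilinProd (mulTerm V q.1 q.2) S T)
    (hasSum_matrix fun i j => ?_) (hasSum_mnorm_mul S T)
    fun q => mnorm_bilinProd_mulTerm_le q.1 q.2 S T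
  exact hasSum_sum (s := Finset.univ)
    (f := fun a (q : ℕ × ℕ) => mulTerm V q.1 q.2 (S i a) (T a j)) fun a _ => hasSum_mul (S i a) (T a j)

/-! ### Generation by `V` and associativity. -/

variable (V) in
/-- The product of the Haagerup tensor algebra as a bounded bilinear map. -/
abbrev mulCLM : HaagerupTensorAlgebra V →L[ℂ] HaagerupTensorAlgebra V →L[ℂ]
    HaagerupTensorAlgebra V :=
  (mulLinear_cc (V := V)).toCLM

variable (V) in
/-- The inclusion of the `n`-th summand as a bounded linear map. -/
abbrev powInclusion (n : ℕ) : HaagerupPow V n →L[ℂ] HaagerupTensorAlgebra V :=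
  lp.singleContinuousLinearMap ℂ (fun n : ℕ => HaagerupPow V n) 1 n

lemma powInclusion_mul (a b : ℕ) (s : HaagerupPow V a) (t : HaagerupPow V b) :
    powInclusion V a s * powInclusion V b t =
      powInclusion V (a + b + 1) (powMul V a b s t) := by
  refine (hasSum_mul _ _).unique ?_
  convert hasSum_single (a, b) fun q hq => ?_
  · simp only [mulTerm_apply, lp.singleContinuousLinearMap_apply, lp.single_apply_self]
  · rw [mulTerm_apply]
    by_cases h : q.1 = a
    · have h' : q.2 ≠ b := fun h' => hq (Prod.ext h h')
      simp only [lp.singleContinuousLinearMap_apply]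
      rw [lp.single_apply_ne (E := fun n => HaagerupPow V n) _ _ _ h', map_zero, lp.single_zero]
    · simp only [lp.singleContinuousLinearMap_apply]
      rw [lp.single_apply_ne (E := fun n => HaagerupPow V n) _ _ _ h, map_zero,
        LinearMap.zero_apply, lp.single_zero]

variable (V) in
/-- The canonical bilinear map `V^{⊗_h (n+1)} × V → V^{⊗_h (n+2)}`. -/
def powTmul (n : ℕ) : HaagerupPow V n →ₗ[ℂ] V →ₗ[ℂ] HaagerupPow V (n + 1) :=
  tmul (HaagerupPow V n) V

/-- This is `powInclusion_mul` with `b = 0`, where `powMul` is `tmul` by definition. It turns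
tensoring by `v` into multiplication by `v`. -/
lemma powInclusion_powTmul (n : ℕ) (s : HaagerupPow V n) (v : V) :
    powInclusion V (n + 1) (powTmul V n s v) =
      powInclusion V n s * tensorInclusion V v :=
  (powInclusion_mul n 0 s v).symm

/-- Finite sums of homogeneous elements are dense in an `ℓ¹`-sum; the side condition closed by
`simp` is that the exponent is not `∞`. -/
lemma haagerupTensorAlgebra_ext {F : Type*} [NormedAddCommGroup F] [NormedSpace ℂ F]
    {f g : HaagerupTensorAlgebra V →L[ℂ] F}
    (h : ∀ n s, f (powInclusion V n s) = g (powInclusion V n s)) : f = g :=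
  lp.ext_continuousLinearMap (by simp) fun n => ContinuousLinearMap.ext (h n)

lemma haagerupPow_succ_ext {F : Type*} [NormedAddCommGroup F] [NormedSpace ℂ F] {n : ℕ}
    {f g : HaagerupPow V (n + 1) →L[ℂ] F}
    (h : ∀ s v, f (powTmul V n s v) = g (powTmul V n s v)) : f = g :=
  haagerupTensor_ext (X := HaagerupPow V n) (Y := V) h

/-- Two bounded linear maps on the Haagerup tensor algebra agree if they agree on `V` and if
agreement at `x` implies agreement at `x v` for every `v` in `V`. -/
lemma haagerupTensorAlgebra_induction {F : Type*} [NormedAddCommGroup F] [NormedSpace ℂ F]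
    {f g : HaagerupTensorAlgebra V →L[ℂ] F}
    (h0 : ∀ v, f (tensorInclusion V v) = g (tensorInclusion V v))
    (h1 : ∀ x v, f x = g x → f (x * tensorInclusion V v) = g (x * tensorInclusion V v)) :
    f = g := by
  refine haagerupTensorAlgebra_ext fun n => ?_
  -- Index 0 is `V` itself. In index `n + 1`, bounded maps are determined on elementary tensors `s ⊗
  -- v`, which are the products `s * v` with `s` of index `n`.
  induction n with
  | zero => exact h0
  | succ n ih =>
    refine DFunLike.congr_fun (haagerupPow_succ_ext (f := f.comp (powInclusion V (n + 1)))
      (g := g.comp (powInclusion V (n + 1))) fun s v => ?_)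
    simp only [ContinuousLinearMap.comp_apply, powInclusion_powTmul]
    exact h1 _ v (ih s)

lemma powMul_powTmul (a b : ℕ) (x : HaagerupPow V a) (y : HaagerupPow V b) (v : V) :
    powMul V a (b + 1) x (powTmul V b y v) =
      powTmul V (a + b + 1) (powMul V a b x y) v :=
  tensorExtend_tmul (powMulAux V a b).2 x y v

lemma mul_assoc_tensorInclusion (x y : HaagerupTensorAlgebra V) (v : V) :
    x * y * tensorInclusion V v = x * (y * tensorInclusion V v) := by
  let R : HaagerupTensorAlgebra V →L[ℂ] HaagerupTensorAlgebra V :=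
    (mulCLM V).flip (tensorInclusion V v)
  -- The two sides are `x ↦ (y ↦ (x * y) * v)` and `x ↦ (y ↦ x * (y * v))` as bounded maps, so
  -- density can be applied in `x` and then in `y`.
  suffices h : (ContinuousLinearMap.compL ℂ _ _ _ R).comp (mulCLM V) =
      ((ContinuousLinearMap.compL ℂ _ _ _).flip R).comp (mulCLM V) from
    DFunLike.congr_fun (DFunLike.congr_fun h x) y
  refine haagerupTensorAlgebra_ext fun a s => haagerupTensorAlgebra_ext fun b t => ?_
  change powInclusion V a s * powInclusion V b t * tensorInclusion V v =
    powInclusion V a s * (powInclusion V b t * tensorInclusion V v)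
  rw [powInclusion_mul, ← powInclusion_powTmul, ← powInclusion_powTmul, powInclusion_mul]
  -- On homogeneous elements the identity is the recursion defining `powMul` in its second factor.
  exact congrArg (powInclusion V (a + b + 1 + 1)) (powMul_powTmul a b s t v).symm

lemma haagerupTensorAlgebra_mul_assoc (x y z : HaagerupTensorAlgebra V) :
    x * y * z = x * (y * z) := by
  suffices h : mulCLM V (x * y) = (mulCLM V x).comp (mulCLM V y) from DFunLike.congr_fun h z
  refine haagerupTensorAlgebra_induction (mul_assoc_tensorInclusion x y) fun z v h => ?_
  change x * y * z = x * (y * z) at h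
  change x * y * (z * tensorInclusion V v) = x * (y * (z * tensorInclusion V v))
  -- `(xy)(zv) = ((xy)z)v = (x(yz))v = x((yz)v) = x(y(zv))`.
  rw [← mul_assoc_tensorInclusion, h, mul_assoc_tensorInclusion, mul_assoc_tensorInclusion]

lemma isMatricialBanachAlgebra_haagerupTensorAlgebra :
    IsMatricialBanachAlgebra (HaagerupTensorAlgebra V) where
  complete := inferInstance
  mul_assoc := haagerupTensorAlgebra_mul_assoc
  add_mul := (mulLinear V).map_add₂
  mul_add x := (mulLinear V x).map_add
  smul_mul := (mulLinear V).map_smul₂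
  mul_smul c x := (mulLinear V x).map_smul c
  mnorm_mul_le S T := mulLinear_cc _ _ _ S T

end Product

/-! ### Extension to a homomorphism, and its uniqueness. -/

section UniversalProperty

variable {V : Type u} [NormedAddCommGroup V] [NormedSpace ℂ V] [MatrixNormedSpace V]
  [CompleteSpace V] {B : Type w} [NormedAddCommGroup B] [NormedSpace ℂ B] [MatrixNormedSpace B]
  [Mul B]

/-- The product of a matricial Banach algebra as a bilinear map. -/
def IsMatricialBanachAlgebra.mulLinear (hB : IsMatricialBanachAlgebra B) : B →ₗ[ℂ] B →ₗ[ℂ] B :=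
  LinearMap.mk₂ ℂ (fun x y => x * y) hB.add_mul hB.smul_mul hB.mul_add hB.mul_smul

lemma IsMatricialBanachAlgebra.mulLinear_cc (hB : IsMatricialBanachAlgebra B) :
    IsCCBilinear hB.mulLinear := fun _ _ _ S T => hB.mnorm_mul_le S T

/-- Used to make `(s, v) ↦ ψ s * φ v` a valid input of `haagerupLift`. -/
lemma IsCCBilinear.compl₁₂ {X₁ X₂ Y₁ Y₂ Z : Type*}
    [NormedAddCommGroup X₁] [NormedSpace ℂ X₁] [MatrixNormedSpace X₁]
    [NormedAddCommGroup X₂] [NormedSpace ℂ X₂] [MatrixNormedSpace X₂]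
    [NormedAddCommGroup Y₁] [NormedSpace ℂ Y₁] [MatrixNormedSpace Y₁]
    [NormedAddCommGroup Y₂] [NormedSpace ℂ Y₂] [MatrixNormedSpace Y₂]
    [NormedAddCommGroup Z] [NormedSpace ℂ Z] [MatrixNormedSpace Z]
    {β : Y₁ →ₗ[ℂ] Y₂ →ₗ[ℂ] Z} (hβ : IsCCBilinear β) {f : X₁ →ₗ[ℂ] Y₁} {g : X₂ →ₗ[ℂ] Y₂}
    (hf : IsCompletelyContractive f) (hg : IsCompletelyContractive g) :
    IsCCBilinear (β.compl₁₂ f g) := fun m p n S T =>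
  (hβ m p n (S.map f) (T.map g)).trans
    (mul_le_mul (hf _ _ S) (hg _ _ T) (mnorm_nonneg _) (mnorm_nonneg _))

/-- The completely contractive map `v₀ ⊗ ⋯ ⊗ vₙ ↦ φ v₀ ⋯ φ vₙ` on a Haagerup tensor power. -/
def powLift (hB : IsMatricialBanachAlgebra B) {φ : V →ₗ[ℂ] B} (hφ : IsCompletelyContractive φ) :
    (n : ℕ) → {ψ : HaagerupPow V n →ₗ[ℂ] B // IsCompletelyContractive ψ}
  | 0 => ⟨φ, hφ⟩
  -- The recursion carries complete contractivity along with the map, because `haagerupLift` at the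
  -- next degree requires it.
  | n + 1 =>
    haveI := hB.complete
    ⟨(haagerupLift (hB.mulLinear_cc.compl₁₂ (powLift hB hφ n).2 hφ) :
      HaagerupTensor (HaagerupPow V n) V →ₗ[ℂ] B), haagerupLift_cc _⟩

lemma powLift_powTmul (hB : IsMatricialBanachAlgebra B) {φ : V →ₗ[ℂ] B}
    (hφ : IsCompletelyContractive φ) (n : ℕ) (s : HaagerupPow V n) (v : V) :
    (powLift hB hφ (n + 1)).1 (powTmul V n s v) = (powLift hB hφ n).1 s * φ v :=
  haveI := hB.complete
  haagerupLift_tmul (hB.mulLinear_cc.compl₁₂ (powLift hB hφ n).2 hφ) s v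

/-- All the maps `powLift` have norm at most 1, so the series is dominated by the `ℓ¹` norm of `x`
and converges in the complete space `B`. -/
lemma summable_powLift (hB : IsMatricialBanachAlgebra B) {φ : V →ₗ[ℂ] B}
    (hφ : IsCompletelyContractive φ) (x : HaagerupTensorAlgebra V) :
    Summable fun n => (powLift hB hφ n).1 (x n) :=
  haveI := hB.complete
  Summable.of_norm_bounded (lp_summable_norm x) fun n => (powLift hB hφ n).2.norm_le (x n)

/-- The homomorphism on the Haagerup tensor algebra induced by a completely contractive map
into a matricial Banach algebra. -/
def algebraLift (hB : IsMatricialBanachAlgebra B) {φ : V →ₗ[ℂ] B}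
    (hφ : IsCompletelyContractive φ) : HaagerupTensorAlgebra V →ₗ[ℂ] B where
  toFun x := ∑' n, (powLift hB hφ n).1 (x n)
  map_add' x y := by
    rw [← (summable_powLift hB hφ x).tsum_add (summable_powLift hB hφ y)]
    exact tsum_congr fun n => map_add (powLift hB hφ n).1 (x n) (y n)
  map_smul' c x := by
    rw [RingHom.id_apply, ← (summable_powLift hB hφ x).tsum_const_smul]
    exact tsum_congr fun n => map_smul (powLift hB hφ n).1 c (x n)

variable (hB : IsMatricialBanachAlgebra B) {φ : V →ₗ[ℂ] B} (hφ : IsCompletelyContractive φ)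

/-- Each degree contributes at most `‖π_k A‖`, and these norms add up to `‖A‖`: this is where the
`ℓ¹` norm is needed. -/
lemma algebraLift_cc : IsCompletelyContractive (algebraLift hB hφ) := fun m n A =>
  mnorm_le_of_hasSum (f := fun k => (coordMat A k).map (powLift hB hφ k).1)
    (hasSum_matrix fun i j => (summable_powLift hB hφ (A i j)).hasSum) (hasSum_coordMat A)
    fun k => (powLift hB hφ k).2 m n (coordMat A k)

lemma algebraLift_powInclusion (n : ℕ) (s : HaagerupPow V n) :
    algebraLift hB hφ (powInclusion V n s) = (powLift hB hφ n).1 s := by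
  refine (summable_powLift hB hφ _).hasSum.unique ?_
  convert hasSum_single n fun k hk => ?_
  · rw [lp.singleContinuousLinearMap_apply, lp.single_apply_self]
  · rw [lp.singleContinuousLinearMap_apply,
      lp.single_apply_ne (E := fun n => HaagerupPow V n) _ _ _ hk, map_zero]

lemma algebraLift_tensorInclusion (v : V) :
    algebraLift hB hφ (tensorInclusion V v) = φ v := algebraLift_powInclusion hB hφ 0 v

/-- By density `x` may be taken homogeneous, and then this is the recursion defining `powLift`. -/
lemma algebraLift_mul_tensorInclusion (x : HaagerupTensorAlgebra V) (v : V) :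
    algebraLift hB hφ (x * tensorInclusion V v) = algebraLift hB hφ x * φ v := by
  suffices h : (algebraLift_cc hB hφ).toCLM.comp ((mulCLM V).flip (tensorInclusion V v)) =
      (hB.mulLinear_cc.toCLM.flip (φ v)).comp (algebraLift_cc hB hφ).toCLM from
    DFunLike.congr_fun h x
  refine haagerupTensorAlgebra_ext fun n s => ?_
  change algebraLift hB hφ (powInclusion V n s * tensorInclusion V v) =
    algebraLift hB hφ (powInclusion V n s) * φ v
  rw [← powInclusion_powTmul, algebraLift_powInclusion, algebraLift_powInclusion,
    powLift_powTmul]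

lemma algebraLift_mul (x y : HaagerupTensorAlgebra V) :
    algebraLift hB hφ (x * y) = algebraLift hB hφ x * algebraLift hB hφ y := by
  suffices h : (algebraLift_cc hB hφ).toCLM.comp (mulCLM V x) =
      (hB.mulLinear_cc.toCLM (algebraLift hB hφ x)).comp (algebraLift_cc hB hφ).toCLM from
    DFunLike.congr_fun h y
  refine haagerupTensorAlgebra_induction (fun v => ?_) fun y v h => ?_
  · change algebraLift hB hφ (x * tensorInclusion V v) =
      algebraLift hB hφ x * algebraLift hB hφ (tensorInclusion V v)
    rw [algebraLift_mul_tensorInclusion, algebraLift_tensorInclusion]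
  · change algebraLift hB hφ (x * y) = algebraLift hB hφ x * algebraLift hB hφ y at h
    change algebraLift hB hφ (x * (y * tensorInclusion V v)) =
      algebraLift hB hφ x * algebraLift hB hφ (y * tensorInclusion V v)
    -- With `ψ` the lift: `ψ(x(yv)) = ψ((xy)v) = ψ(xy) φ(v) = (ψ(x) ψ(y)) φ(v)`, and associativity
    -- in `B` finishes.
    rw [← mul_assoc_tensorInclusion, algebraLift_mul_tensorInclusion, h,
      algebraLift_mul_tensorInclusion, hB.mul_assoc]

/-- Completely contractive homomorphisms on the Haagerup tensor algebra agree if they agree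
on `V`. -/
lemma haagerupTensorAlgebra_hom_ext {ψ χ : HaagerupTensorAlgebra V →ₗ[ℂ] B}
    (hψ : IsCompletelyContractive ψ) (hχ : IsCompletelyContractive χ)
    (mψ : ∀ x y, ψ (x * y) = ψ x * ψ y) (mχ : ∀ x y, χ (x * y) = χ x * χ y)
    (h : ∀ v, ψ (tensorInclusion V v) = χ (tensorInclusion V v)) : ψ = χ := by
  -- Complete contractivity enters only through boundedness, which the density argument needs.
  suffices hh : hψ.toCLM = hχ.toCLM from LinearMap.ext fun x => DFunLike.congr_fun hh x
  refine haagerupTensorAlgebra_induction h fun x v hx => ?_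
  change ψ x = χ x at hx
  change ψ (x * tensorInclusion V v) = χ (x * tensorInclusion V v)
  rw [mψ, mχ, hx, h]

end UniversalProperty

end

end MatricialBanach

theorem mainTheorem4 {V : Type*} [NormedAddCommGroup V] [NormedSpace ℂ V]
    [MatricialBanach.MatrixNormedSpace V] [CompleteSpace V] :
    MatricialBanach.IsMatricialBanachAlgebra (MatricialBanach.HaagerupTensorAlgebra V) ∧
    ∀ {B : Type*} [NormedAddCommGroup B] [NormedSpace ℂ B]
      [MatricialBanach.MatrixNormedSpace B] [Mul B],
      MatricialBanach.IsMatricialBanachAlgebra B →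
      ∀ φ : V →ₗ[ℂ] B, MatricialBanach.IsCompletelyContractive φ →
        ∃! ψ : MatricialBanach.HaagerupTensorAlgebra V →ₗ[ℂ] B,
          MatricialBanach.IsCompletelyContractive ψ ∧
          (∀ x y, ψ (x * y) = ψ x * ψ y) ∧
          ∀ v, ψ (MatricialBanach.tensorInclusion V v) = φ v := by
  refine ⟨MatricialBanach.isMatricialBanachAlgebra_haagerupTensorAlgebra, ?_⟩
  intro B _ _ _ _ hB φ hφ
  refine ⟨MatricialBanach.algebraLift hB hφ, ⟨MatricialBanach.algebraLift_cc hB hφ,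
    MatricialBanach.algebraLift_mul hB hφ, MatricialBanach.algebraLift_tensorInclusion hB hφ⟩, ?_⟩
  rintro χ ⟨hχ, mχ, eχ⟩
  exact MatricialBanach.haagerupTensorAlgebra_hom_ext hχ (MatricialBanach.algebraLift_cc hB hφ)
    mχ (MatricialBanach.algebraLift_mul hB hφ)
    fun v => (eχ v).trans (MatricialBanach.algebraLift_tensorInclusion hB hφ v).symm
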